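/- A \emph{weight} is a continuous, non-increasing function $v\colon[0,1)\to(0,\infty)$; put $v(z):=v(|z|)$ for $z\in\mathbb D=\{z\in\mathbb C:|z|<1\}$. Let $H(\mathbb D)$ be the space of holomorphic functions on $\mathbb D$, and let $$H_v^\infty=\{f\in H(\mathbb D):\ \|f\|_{\infty,v}:=\sup_{z\in\mathbb D}|f(z)|v(z)<\infty\},\qquad H_v^0=\{f\in H(\mathbb D):\ \lim_{|z|\to1^-}|f(z)|v(z)=0\},$$ both with the norm $\|\cdot\|_{\infty,v}$. For $t\in[0,1)$ and $f\in H(\mathbb D)$ let $C_tf(0)=f(0)$ and $C_tf(z)=\frac1z\int_0^z\frac{f(\xi)}{1-t\xi}\,d\xi$ for $z\in\mathbb D\setminus\{0\}$. A bounded linear operator $T$ on a complex normed space $X$ is \emph{power bounded} if $\sup_{n\ge0}\|T^n\|<\infty$, \emph{uniformly mean ergodic} if $\left(\frac1n\sum_{m=1}^nT^m\right)_{n\ge1}$ converges in operator norm, and \emph{supercyclic} if $\{\lambda T^nx:\lambda\in\mathbb C,\ n\ge0\}$ is dense in $X$ for some $x\in X$. \textbf{Proposition.} Let $v$ be a weight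 with $\lim_{r\to1^-}v(r)=0$ and let $t\in[0,1)$. Let $X$ be either $H_v^\infty$ or $H_v^0$. Then $C_t$ maps $X$ into $X$ and is a bounded linear operator on $X$; it is power bounded and uniformly mean ergodic, and it is not supercyclic. Moreover, on $X$, $\operatorname{Ker}(I-C_t)=\operatorname{span}\{g_0\}$, where $g_0(z)=\frac1{1-tz}$ (which belongs to $X$), and $\operatorname{Im}(I-C_t)=\{g\in X: g(0)=0\}$. -/

import Mathlib

open Filter Topology

noncomputable section

/-- A weight: a continuous, non-increasing function `v : [0,1) → (0,∞)`.  (The function is carried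
by all of `ℝ`, but only its values on `[0,1)` are constrained and only these are ever used.) -/
structure Weight where
  toFun : ℝ → ℝ
  continuousOn' : ContinuousOn toFun (Set.Ico 0 1)
  antitoneOn' : AntitoneOn toFun (Set.Ico 0 1)
  pos' : ∀ r ∈ Set.Ico (0 : ℝ) 1, 0 < toFun r

instance : CoeFun Weight (fun _ => ℝ → ℝ) := ⟨Weight.toFun⟩

namespace Weight

theorem pos_norm (v : Weight) {z : ℂ} (hz : z ∈ Metric.ball (0 : ℂ) 1) : 0 < v ‖z‖ :=
  v.pos' _ ⟨norm_nonneg z, by simpa using hz⟩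

end Weight

/-- The holomorphic functions on the open unit disc.  A function on the disc is represented by its
extension by `0` to `ℂ`, so that equality in this space is equality on the disc. -/
def holoDisc : Submodule ℂ (ℂ → ℂ) where
  carrier := {f | DifferentiableOn ℂ f (Metric.ball 0 1) ∧ ∀ z ∉ Metric.ball (0 : ℂ) 1, f z = 0}
  add_mem' := by
    rintro f g ⟨hf, hf0⟩ ⟨hg, hg0⟩
    exact ⟨hf.add hg, fun z hz => by simp [hf0 z hz, hg0 z hz]⟩
  zero_mem' := ⟨differentiableOn_const 0, fun _ _ => rfl⟩
  smul_mem' := by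
    rintro c f ⟨hf, hf0⟩
    exact ⟨hf.const_smul c, fun z hz => by simp [hf0 z hz]⟩

/-- `|f(z)| v(z)`, where `v(z) = v(|z|)`. -/
def wmod (v : Weight) (f : ℂ → ℂ) (z : ℂ) : ℝ := ‖f z‖ * v ‖z‖

/-- The subspace of all `f ∈ H(𝔻)` with `sup_{z ∈ 𝔻} |f(z)| v(z) < ∞`. -/
def HvInfSubmodule (v : Weight) : Submodule ℂ (ℂ → ℂ) where
  carrier := {f | f ∈ holoDisc ∧
    BddAbove (Set.range fun z : Metric.ball (0 : ℂ) 1 => wmod v f z)}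
  add_mem' := by
    rintro f g ⟨hf, A, hA⟩ ⟨hg, B, hB⟩
    refine ⟨holoDisc.add_mem hf hg, A + B, ?_⟩
    rintro _ ⟨z, rfl⟩
    have h1 := hA ⟨z, rfl⟩
    have h2 := hB ⟨z, rfl⟩
    have h3 := mul_le_mul_of_nonneg_right (norm_add_le (f z) (g z)) (v.pos_norm z.2).le
    simp only [wmod, Pi.add_apply] at *
    linarith
  zero_mem' := ⟨holoDisc.zero_mem, 0, by rintro _ ⟨z, rfl⟩; simp [wmod]⟩
  smul_mem' := by
    rintro c f ⟨hf, A, hA⟩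
    refine ⟨holoDisc.smul_mem c hf, ‖c‖ * A, ?_⟩
    rintro _ ⟨z, rfl⟩
    have h := mul_le_mul_of_nonneg_left (hA ⟨z, rfl⟩) (norm_nonneg c)
    simpa [wmod, mul_assoc] using h

/-- The weighted Banach space `H_v^∞`.  This is a type of its own, so that it carries only the
topology of the weighted sup-norm below. -/
def HvInf (v : Weight) : Type := HvInfSubmodule v

namespace HvInf

variable {v : Weight}

instance : AddCommGroup (HvInf v) := inferInstanceAs (AddCommGroup (HvInfSubmodule v))

instance : Module ℂ (HvInf v) := inferInstanceAs (Module ℂ (HvInfSubmodule v))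

instance : CoeFun (HvInf v) (fun _ => ℂ → ℂ) := ⟨fun f => f.1⟩

@[simp] theorem add_apply (f g : HvInf v) (z : ℂ) : (f + g) z = f z + g z := rfl

@[simp] theorem sub_apply (f g : HvInf v) (z : ℂ) : (f - g) z = f z - g z := rfl

@[simp] theorem zero_apply (z : ℂ) : (0 : HvInf v) z = 0 := rfl

@[simp] theorem smul_apply (c : ℂ) (f : HvInf v) (z : ℂ) : (c • f) z = c * f z := rfl

theorem ext' {f g : HvInf v} (h : ∀ z ∈ Metric.ball (0 : ℂ) 1, f z = g z) : f = g := by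
  refine Subtype.ext (funext fun z => ?_)
  by_cases hz : z ∈ Metric.ball (0 : ℂ) 1
  · exact h z hz
  · exact (f.2.1.2 z hz).trans (g.2.1.2 z hz).symm

/-- The norm `‖f‖ = sup_{z ∈ 𝔻} |f(z)| v(z)`. -/
instance : Norm (HvInf v) := ⟨fun f => ⨆ z : Metric.ball (0 : ℂ) 1, wmod v f z⟩

theorem norm_def (f : HvInf v) : ‖f‖ = ⨆ z : Metric.ball (0 : ℂ) 1, wmod v f z := rfl

theorem wmod_le_norm (f : HvInf v) (z : ℂ) (hz : z ∈ Metric.ball (0 : ℂ) 1) :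
    wmod v f z ≤ ‖f‖ :=
  le_ciSup f.2.2 (⟨z, hz⟩ : Metric.ball (0 : ℂ) 1)

theorem wmod_nonneg (f : ℂ → ℂ) (z : ℂ) (hz : z ∈ Metric.ball (0 : ℂ) 1) : 0 ≤ wmod v f z :=
  mul_nonneg (norm_nonneg _) (v.pos_norm hz).le

theorem normCore : NormedSpace.Core ℂ (HvInf v) where
  norm_nonneg f := Real.iSup_nonneg fun z => wmod_nonneg f z z.2
  norm_smul c f := by
    rw [norm_def, norm_def, Real.mul_iSup_of_nonneg (norm_nonneg c)]
    refine iSup_congr fun z => ?_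
    simp [wmod, mul_assoc]
  norm_triangle f g := by
    have : Nonempty (Metric.ball (0 : ℂ) 1) := ⟨⟨0, by simp⟩⟩
    refine ciSup_le fun z => ?_
    have h1 := wmod_le_norm f z z.2
    have h2 := wmod_le_norm g z z.2
    have h3 := mul_le_mul_of_nonneg_right (norm_add_le (f z) (g z)) (v.pos_norm z.2).le
    simp only [wmod, add_apply] at *
    linarith
  norm_eq_zero_iff f := by
    constructor
    · intro h
      refine ext' fun z hz => ?_
      have h1 := wmod_le_norm f z hz
      rw [h] at h1
      have h2 : ‖f z‖ * v ‖z‖ = 0 := le_antisymm h1 (wmod_nonneg f z hz)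
      rcases mul_eq_zero.1 h2 with h3 | h3
      · simpa using h3
      · exact absurd h3 (v.pos_norm hz).ne'
    · rintro rfl
      simp [norm_def, wmod]

instance : NormedAddCommGroup (HvInf v) := NormedAddCommGroup.ofCore normCore

instance : NormedSpace ℂ (HvInf v) := NormedSpace.ofCore normCore

end HvInf

/-- `lim_{|z| → 1⁻} |f(z)| v(z) = 0`. -/
def VanishesAtBoundary (v : Weight) (f : ℂ → ℂ) : Prop :=
  Tendsto (wmod v f) (comap (fun z : ℂ => ‖z‖) (𝓝[<] 1)) (𝓝 0)

/-- The space `H_v^0`, with the norm inherited from `H_v^∞`.  Membership in `H_v^∞` is no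
restriction: see `mem_HvInfSubmodule_of_vanishes`. -/
def HvZero (v : Weight) : Submodule ℂ (HvInf v) where
  carrier := {f | VanishesAtBoundary v f}
  add_mem' := by
    intro f g hf hg
    have hfg := hf.add hg
    rw [add_zero] at hfg
    have hev : ∀ᶠ z in comap (fun z : ℂ => ‖z‖) (𝓝[<] 1), z ∈ Metric.ball (0 : ℂ) 1 := by
      filter_upwards [tendsto_comap.eventually
        (self_mem_nhdsWithin : Set.Iio (1 : ℝ) ∈ 𝓝[<] (1 : ℝ))] with z hz
      simpa using hz
    refine squeeze_zero' (hev.mono fun z hz => HvInf.wmod_nonneg _ z hz)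
      (hev.mono fun z hz => ?_) hfg
    have h3 := mul_le_mul_of_nonneg_right (norm_add_le (f z) (g z)) (v.pos_norm hz).le
    simp only [wmod, HvInf.add_apply] at *
    linarith
  zero_mem' := by
    have : wmod v (0 : HvInf v) = fun _ => 0 := by funext z; simp [wmod]
    simp only [Set.mem_ofPred_eq, VanishesAtBoundary, this]
    exact tendsto_const_nhds
  smul_mem' := by
    intro c f hf
    have h := hf.const_mul ‖c‖
    rw [mul_zero] at h
    refine h.congr fun z => ?_
    simp [wmod, mul_assoc]

/-- A holomorphic function on the disc with `lim_{|z| → 1⁻} |f(z)| v(z) = 0` lies in `H_v^∞`. -/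
theorem mem_HvInfSubmodule_of_vanishes (v : Weight) {f : ℂ → ℂ} (hf : f ∈ holoDisc)
    (h0 : VanishesAtBoundary v f) : f ∈ HvInfSubmodule v := by
  refine ⟨hf, ?_⟩
  have h1 : ∀ᶠ z in comap (fun z : ℂ => ‖z‖) (𝓝[<] 1), wmod v f z < 1 :=
    h0.eventually (gt_mem_nhds one_pos)
  rw [eventually_comap] at h1
  obtain ⟨r, hr, hrs⟩ := (mem_nhdsLT_iff_exists_Ioo_subset' (show (0 : ℝ) < 1 by norm_num)).1 h1
  have hr1 : r < 1 := hr
  have hsub : Metric.closedBall (0 : ℂ) r ⊆ Metric.ball 0 1 := Metric.closedBall_subset_ball hr1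
  obtain ⟨M, hM⟩ := (isCompact_closedBall (0 : ℂ) r).exists_bound_of_continuousOn
    (hf.1.continuousOn.mono hsub)
  refine ⟨max 1 (M * v 0), ?_⟩
  rintro _ ⟨⟨z, hz⟩, rfl⟩
  have hz1 : ‖z‖ < 1 := by simpa using hz
  rcases le_or_gt ‖z‖ r with h | h
  · refine le_max_of_le_right ?_
    have hfM : ‖f z‖ ≤ M := hM z (by simpa using h)
    exact mul_le_mul hfM
      (v.antitoneOn' ⟨le_rfl, one_pos⟩ ⟨norm_nonneg z, hz1⟩ (norm_nonneg z))
      (v.pos_norm hz).le ((norm_nonneg _).trans hfM)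
  · exact le_max_of_le_left (hrs ⟨h, hz1⟩ z rfl).le

/-- The line integral `∫_0^z g(ξ) dξ` along the segment `ξ = s z`, `0 ≤ s ≤ 1`. -/
def segmentIntegral (g : ℂ → ℂ) (z : ℂ) : ℂ := ∫ s in (0 : ℝ)..1, g (s * z) * z

/-- The generalized Cesàro operator: `C_t f(0) = f(0)` and
`C_t f(z) = (1/z) ∫_0^z f(ξ)/(1 - tξ) dξ` for `z ∈ 𝔻 \ {0}`. -/
def cesaro (t : ℝ) (f : ℂ → ℂ) (z : ℂ) : ℂ :=
  if z = 0 then f 0 else (1 / z) * segmentIntegral (fun ξ => f ξ / (1 - t * ξ)) z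

section Dynamics

variable {X : Type*} [NormedAddCommGroup X] [NormedSpace ℂ X]

/-- `sup_n ‖T^n‖ < ∞`. -/
def PowerBounded (T : X →L[ℂ] X) : Prop := ∃ M : ℝ, ∀ n : ℕ, ‖T ^ n‖ ≤ M

/-- The Cesàro means `T_[n] = (1/n) ∑_{m=1}^n T^m` (used for `n ≥ 1`). -/
def cesaroMean (T : X →L[ℂ] X) (n : ℕ) : X →L[ℂ] X :=
  (n : ℂ)⁻¹ • ∑ m ∈ Finset.Icc 1 n, T ^ m

/-- The Cesàro means converge in the operator norm. -/
def UniformlyMeanErgodic (T : X →L[ℂ] X) : Prop :=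
  ∃ P : X →L[ℂ] X, Tendsto (cesaroMean T) atTop (𝓝 P)

/-- Some projective orbit `{λ T^n x : λ ∈ ℂ, n ∈ ℕ₀}` is dense. -/
def Supercyclic (T : X →L[ℂ] X) : Prop :=
  ∃ x : X, Dense {y : X | ∃ (c : ℂ) (n : ℕ), y = c • (T ^ n) x}

end Dynamics

end

/-! Let `φ` be evaluation at `0` and `g` the function `1 / (1 - t z)`. Then `C_t g = g`, `φ g = 1`
and `φ ∘ C_t = φ`, so everything rests on how `C_t` acts on the kernel of `φ`. There its powers
decay like `2⁻ⁿ`.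

The decay comes from comparison with a radial majorant: `r / (1 - t r)^2` is an eigenfunction for
the eigenvalue `1/2` (`integral_halfEigen`). If `f 0 = 0`, the Schwarz lemma on the disc of radius
`R = ‖z‖` bounds `f` there by a multiple of it (`norm_le_halfEigen_of_forall_le`), and each
application of `C_t` halves the multiple (`norm_cesaro_le_half`). Monotonicity of `v` makes the
bound at `z` uniform after weighting (`HvInf.norm_cesaroCLM_pow_le`).

Hence `C_tⁿ` converges in norm to the rank-one projection `φ(·) g`, which gives all the dynamical
claims; the image of `I - C_t` comes from a Neumann series on the kernel of `φ`. The condition `v →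
0` puts bounded functions in `H_v^0` and makes that space invariant. -/

noncomputable section

/-! ### Operators with geometric decay on the kernel of an invariant functional -/

section RankOneLimit

variable {X : Type*} [NormedAddCommGroup X] [NormedSpace ℂ X] {T : X →L[ℂ] X} {φ : X →L[ℂ] ℂ}
  {g : X} {C : ℝ}

theorem pow_apply_of_fixed (hT : T g = g) (n : ℕ) : (T ^ n) g = g := by
  induction n with
  | zero => simp
  | succ n ih => rw [pow_succ, mul_apply_eq_comp, hT, ih]

theorem pow_apply_invariant (hφ : ∀ x, φ (T x) = φ x) (n : ℕ) (x : X) : φ ((T ^ n) x) = φ x := by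
  induction n with
  | zero => simp
  | succ n ih => rw [pow_succ', mul_apply_eq_comp, hφ, ih]

/-- The vector `x - φ x • g` lies in the kernel of `φ`, and the powers of `T` fix `g`. -/
theorem norm_pow_apply_sub_le (hg : φ g = 1) (hT : T g = g)
    (hC : ∀ n x, φ x = 0 → ‖(T ^ n) x‖ ≤ C * (1 / 2) ^ n * ‖x‖) (n : ℕ) (x : X) :
    ‖(T ^ n) x - φ x • g‖ ≤ C * (1 / 2) ^ n * ‖x - φ x • g‖ := by
  have h := hC n (x - φ x • g) (by simp [hg])
  rwa [map_sub, map_smul, pow_apply_of_fixed hT] at h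

theorem tendsto_pow_smulRight (hC0 : 0 ≤ C) (hg : φ g = 1) (hT : T g = g)
    (hC : ∀ n x, φ x = 0 → ‖(T ^ n) x‖ ≤ C * (1 / 2) ^ n * ‖x‖) :
    Tendsto (fun n : ℕ => T ^ n) atTop (𝓝 (φ.smulRight g)) := by
  set Q : X →L[ℂ] X := 1 - φ.smulRight g with hQ
  rw [tendsto_iff_norm_sub_tendsto_zero]
  refine squeeze_zero (g := fun n : ℕ => C * (1 / 2) ^ n * ‖Q‖) (fun n => norm_nonneg _)
    (fun n => ContinuousLinearMap.opNorm_le_bound _ (by positivity) fun x => ?_) ?_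
  · have h := norm_pow_apply_sub_le hg hT hC n x
    have hx : ‖x - φ x • g‖ ≤ ‖Q‖ * ‖x‖ := by simpa [hQ] using Q.le_opNorm x
    calc ‖(T ^ n - φ.smulRight g) x‖ ≤ C * (1 / 2) ^ n * ‖x - φ x • g‖ := by simpa using h
      _ ≤ C * (1 / 2) ^ n * (‖Q‖ * ‖x‖) := by gcongr
      _ = _ := by ring
  · have h := ((tendsto_pow_atTop_nhds_zero_of_lt_one (r := (1 / 2 : ℝ)) (by norm_num)
      (by norm_num)).const_mul C).mul_const ‖Q‖
    simpa using h

theorem PowerBounded.of_tendsto {P : X →L[ℂ] X} (h : Tendsto (fun n : ℕ => T ^ n) atTop (𝓝 P)) :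
    PowerBounded T := by
  obtain ⟨M, hM⟩ := h.norm.bddAbove_range
  exact ⟨M, fun n => hM ⟨n, rfl⟩⟩

theorem UniformlyMeanErgodic.of_tendsto {P : X →L[ℂ] X}
    (h : Tendsto (fun n : ℕ => T ^ n) atTop (𝓝 P)) : UniformlyMeanErgodic T := by
  -- Averages of a convergent sequence have the same limit; the shift by one is there because the
  -- means start at `T ^ 1`.
  refine ⟨P, ((tendsto_add_atTop_iff_nat 1).2 h).cesaro_smul.congr fun n => ?_⟩
  rw [cesaroMean, ← Complex.coe_smul, Finset.range_eq_Ico,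
    Finset.sum_Ico_add' (fun m => T ^ m) 0 n 1]
  congr 1
  push_cast
  rfl

/-- A projective orbit stays in a closed cone around the line of `g`, because `φ` is constant along
the orbit while the distance to `φ x • g` stays bounded. The cone misses the nonzero vector `e` of
the kernel. -/
theorem not_supercyclic_of_decay (hC0 : 0 ≤ C) (hg : φ g = 1) (hT : T g = g)
    (hφ : ∀ x, φ (T x) = φ x)
    (hC : ∀ n x, φ x = 0 → ‖(T ^ n) x‖ ≤ C * (1 / 2) ^ n * ‖x‖)
    {e : X} (he : e ≠ 0) (hφe : φ e = 0) : ¬ Supercyclic T := by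
  rintro ⟨x, hx⟩
  set A : ℝ := C * ‖x - φ x • g‖ with hA
  have key : ∀ y : X, ‖y - φ y • g‖ * ‖φ x‖ ≤ A * ‖φ y‖ := by
    have hcl : IsClosed {y : X | ‖y - φ y • g‖ * ‖φ x‖ ≤ A * ‖φ y‖} :=
      isClosed_le (by fun_prop) (by fun_prop)
    refine fun y => (hcl.closure_subset_iff.2 ?_ (hx y) : _)
    rintro _ ⟨c, n, rfl⟩
    have h1 := norm_pow_apply_sub_le hg hT hC n x
    have h2 : ‖(T ^ n) x - φ x • g‖ ≤ A := by
      refine h1.trans ?_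
      rw [hA]
      gcongr
      exact mul_le_of_le_one_right hC0 (pow_le_one₀ (by norm_num) (by norm_num))
    have h3 : c • (T ^ n) x - φ (c • (T ^ n) x) • g = c • ((T ^ n) x - φ x • g) := by
      rw [map_smul, pow_apply_invariant hφ, smul_sub, smul_assoc]
    simp only [Set.mem_ofPred_eq]
    rw [h3, map_smul, pow_apply_invariant hφ, norm_smul, norm_smul]
    calc ‖c‖ * ‖(T ^ n) x - φ x • g‖ * ‖φ x‖ ≤ ‖c‖ * A * ‖φ x‖ := by gcongr
      _ = _ := by ring
  -- Otherwise the orbit lies in the kernel of `φ`, which is closed and omits `g`.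
  have hx0 : φ x ≠ 0 := by
    intro h0
    have hcl : IsClosed {y : X | φ y = 0} := isClosed_eq (by fun_prop) (by fun_prop)
    have h1 : φ g = 0 := by
      refine (hcl.closure_subset_iff.2 ?_ (hx g) : _)
      rintro _ ⟨c, n, rfl⟩
      simp only [Set.mem_ofPred_eq]
      rw [map_smul, pow_apply_invariant hφ, h0, smul_zero]
    simp [hg] at h1
  have h := key e
  rw [hφe] at h
  have : 0 < ‖e‖ * ‖φ x‖ := by positivity
  simp at h
  linarith

theorem fixedPoints_eq_span_of_decay (hg : φ g = 1) (hT : T g = g)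
    (hC : ∀ n x, φ x = 0 → ‖(T ^ n) x‖ ≤ C * (1 / 2) ^ n * ‖x‖) :
    {f : X | f - T f = 0} = (Submodule.span ℂ {g} : Set X) := by
  ext f
  simp only [Set.mem_ofPred_eq, SetLike.mem_coe, Submodule.mem_span_singleton, sub_eq_zero]
  constructor
  · intro hf
    refine ⟨φ f, ?_⟩
    have h : ∀ n : ℕ, ‖f - φ f • g‖ ≤ C * (1 / 2) ^ n * ‖f - φ f • g‖ := fun n => by
      simpa only [pow_apply_of_fixed hf.symm] using norm_pow_apply_sub_le hg hT hC n f
    -- For a fixed point the left side of `h` does not depend on `n`, so it is at most this limit.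
    have hl : Tendsto (fun n : ℕ => C * (1 / 2) ^ n * ‖f - φ f • g‖) atTop (𝓝 0) := by
      simpa using ((tendsto_pow_atTop_nhds_zero_of_lt_one (r := (1 / 2 : ℝ)) (by norm_num)
        (by norm_num)).const_mul C).mul_const ‖f - φ f • g‖
    have := norm_le_zero_iff.1 (ge_of_tendsto' hl h)
    exact (sub_eq_zero.1 this).symm
  · rintro ⟨a, rfl⟩
    rw [map_smul, hT]

theorem range_id_sub_eq_of_decay [CompleteSpace X]
    (hφ : ∀ x, φ (T x) = φ x)
    (hC : ∀ n x, φ x = 0 → ‖(T ^ n) x‖ ≤ C * (1 / 2) ^ n * ‖x‖) :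
    Set.range (fun f : X => f - T f) = {y : X | φ y = 0} := by
  ext y
  simp only [Set.mem_range, Set.mem_ofPred_eq]
  constructor
  · rintro ⟨f, rfl⟩
    simp [hφ]
  · intro hy
    have hs : Summable fun n : ℕ => (T ^ n) y := by
      refine Summable.of_norm_bounded ?_ fun n => hC n y hy
      exact (summable_geometric_two.mul_left C).mul_right ‖y‖
    -- The Neumann series inverts `I - T` on the kernel of `φ`.
    refine ⟨∑' n, (T ^ n) y, ?_⟩
    rw [T.map_tsum hs, hs.tsum_eq_zero_add]
    simp [pow_succ']

end RankOneLimit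

/-! ### Elementary estimates and the integral form of `C_t` -/

theorem one_sub_mul_norm_pos {t : ℝ} (ht0 : 0 ≤ t) (ht1 : t < 1) {z : ℂ}
    (hz : z ∈ Metric.ball (0 : ℂ) 1) : 0 < 1 - t * ‖z‖ := by
  have hz1 : ‖z‖ < 1 := by simpa using hz
  nlinarith [norm_nonneg z]

theorem one_sub_mul_norm_le {t : ℝ} (ht0 : 0 ≤ t) (z : ℂ) : 1 - t * ‖z‖ ≤ ‖1 - t * z‖ := by
  have h := norm_sub_norm_le (1 : ℂ) (t * z)
  simpa [abs_of_nonneg ht0] using h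

theorem one_sub_mul_ne_zero {t : ℝ} (ht0 : 0 ≤ t) (ht1 : t < 1) {z : ℂ}
    (hz : z ∈ Metric.ball (0 : ℂ) 1) : (1 - t * z : ℂ) ≠ 0 :=
  norm_pos_iff.1 ((one_sub_mul_norm_pos ht0 ht1 hz).trans_le (one_sub_mul_norm_le ht0 z))

theorem ofReal_mul_mem_ball {z : ℂ} (hz : z ∈ Metric.ball (0 : ℂ) 1) {s : ℝ}
    (hs : s ∈ Set.Icc (0 : ℝ) 1) : (s * z : ℂ) ∈ Metric.ball (0 : ℂ) 1 := by
  have hz1 : ‖z‖ < 1 := by simpa using hz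
  have : ‖(s * z : ℂ)‖ < 1 := by
    rw [norm_mul, Complex.norm_real, Real.norm_of_nonneg hs.1]
    nlinarith [hs.1, hs.2, norm_nonneg z]
  simpa using this

theorem norm_ofReal_mul {s : ℝ} (hs : 0 ≤ s) (z : ℂ) : ‖(s * z : ℂ)‖ = s * ‖z‖ := by
  rw [norm_mul, Complex.norm_real, Real.norm_of_nonneg hs]

theorem cesaro_zero (t : ℝ) (f : ℂ → ℂ) : cesaro t f 0 = f 0 := by simp [cesaro]

/-- The substitution `ξ = s z` cancels the factor `1 / z`, so one formula also covers the origin. -/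
theorem cesaro_eq_integral (t : ℝ) (f : ℂ → ℂ) (z : ℂ) :
    cesaro t f z = ∫ s in (0 : ℝ)..1, f (s * z) / (1 - t * (s * z)) := by
  unfold cesaro segmentIntegral
  split_ifs with h
  · simp [h]
  · rw [intervalIntegral.integral_mul_const, one_div, mul_comm, mul_assoc, mul_inv_cancel₀ h,
      mul_one]

/-! ### Pointwise bounds and eigenfunctions of `C_t` -/

section Disc

variable {t : ℝ} {f : ℂ → ℂ}

theorem differentiableOn_cesaro_integrand (ht0 : 0 ≤ t) (ht1 : t < 1)
    (hf : DifferentiableOn ℂ f (Metric.ball 0 1)) :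
    DifferentiableOn ℂ (fun ξ => f ξ / (1 - t * ξ)) (Metric.ball 0 1) :=
  hf.div (by fun_prop) fun _ hz => one_sub_mul_ne_zero ht0 ht1 hz

theorem continuousOn_cesaro_integrand (ht0 : 0 ≤ t) (ht1 : t < 1)
    (hf : DifferentiableOn ℂ f (Metric.ball 0 1)) {z : ℂ} (hz : z ∈ Metric.ball (0 : ℂ) 1) :
    ContinuousOn (fun s : ℝ => f (s * z) / (1 - t * (s * z))) (Set.uIcc 0 1) := by
  rw [Set.uIcc_of_le zero_le_one]
  exact (differentiableOn_cesaro_integrand ht0 ht1 hf).continuousOn.comp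
    (f := fun s : ℝ => (s * z : ℂ)) (by fun_prop) fun s hs => ofReal_mul_mem_ball hz hs

/-- With `G` a primitive of the integrand, `C_t f` is the difference quotient of `G` at `0`, whose
singularity is removable. -/
theorem differentiableOn_cesaro (ht0 : 0 ≤ t) (ht1 : t < 1)
    (hf : DifferentiableOn ℂ f (Metric.ball 0 1)) :
    DifferentiableOn ℂ (cesaro t f) (Metric.ball 0 1) := by
  obtain ⟨G, hG⟩ := (differentiableOn_cesaro_integrand ht0 ht1 hf).isExactOn_ball
  have hG' : DifferentiableOn ℂ G (Metric.ball 0 1) := fun z hz =>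
    (hG z hz).differentiableAt.differentiableWithinAt
  have h0 : (0 : ℂ) ∈ Metric.ball (0 : ℂ) 1 := by simp
  refine ((Complex.differentiableOn_dslope (Metric.ball_mem_nhds (0 : ℂ) one_pos)).2 hG').congr
    fun z hz => ?_
  rcases eq_or_ne z 0 with rfl | hz0
  · rw [dslope_same, (hG 0 h0).deriv, cesaro_zero]
    simp
  · rw [dslope_of_ne _ hz0, slope_def_field, cesaro, if_neg hz0, sub_zero]
    have hd : ∀ s ∈ Set.uIcc (0 : ℝ) 1, HasDerivAt (fun s : ℝ => G (s * z))
        (f (s * z) / (1 - t * (s * z)) * z) s := by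
      intro s hs
      rw [Set.uIcc_of_le zero_le_one] at hs
      have h1 : HasDerivAt (fun s : ℝ => (s * z : ℂ)) z s := by
        simpa using (Complex.ofRealCLM.hasDerivAt (x := s)).mul_const z
      exact (hG _ (ofReal_mul_mem_ball hz hs)).comp s h1
    have := intervalIntegral.integral_eq_sub_of_hasDerivAt hd
      ((continuousOn_cesaro_integrand ht0 ht1 hf hz).mul continuousOn_const).intervalIntegrable
    rw [segmentIntegral, this]
    simp
    field_simp

theorem norm_cesaro_le_of_bound (ht0 : 0 ≤ t) (ht1 : t < 1) {z : ℂ}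
    (hz : z ∈ Metric.ball (0 : ℂ) 1) {b : ℝ → ℝ} (hb : ContinuousOn b (Set.Icc 0 1))
    (hfb : ∀ s ∈ Set.Icc (0 : ℝ) 1, ‖f (s * z)‖ ≤ b s) :
    ‖cesaro t f z‖ ≤ ∫ s in (0 : ℝ)..1, b s / (1 - t * (s * ‖z‖)) := by
  rw [cesaro_eq_integral]
  have hpos : ∀ s ∈ Set.Icc (0 : ℝ) 1, 0 < 1 - t * (s * ‖z‖) := fun s hs => by
    simpa only [norm_ofReal_mul hs.1] using
      one_sub_mul_norm_pos ht0 ht1 (ofReal_mul_mem_ball hz hs)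
  refine intervalIntegral.norm_integral_le_of_norm_le zero_le_one
    (Eventually.of_forall fun s hs => ?_) (ContinuousOn.intervalIntegrable ?_)
  · have hs' := Set.Ioc_subset_Icc_self hs
    have h1 := one_sub_mul_norm_le ht0 (s * z)
    rw [norm_ofReal_mul hs'.1] at h1
    rw [norm_div]
    exact div_le_div₀ ((norm_nonneg _).trans (hfb s hs')) (hfb s hs') (hpos s hs') h1
  · rw [Set.uIcc_of_le zero_le_one]
    exact hb.div (by fun_prop) fun s hs => (hpos s hs).ne'

/-- The functions `r / (1 - t r)^2`, an eigenfunction of `C_t` with eigenvalue `1/2`. -/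
def halfEigen (t r : ℝ) : ℝ := r / (1 - t * r) ^ 2

theorem integral_halfEigen (ht0 : 0 ≤ t) (ht1 : t < 1) {r : ℝ} (hr : r ∈ Set.Icc (0 : ℝ) 1) :
    ∫ s in (0 : ℝ)..1, halfEigen t (s * r) / (1 - t * (s * r)) = 1 / 2 * halfEigen t r := by
  have hpos : ∀ s ∈ Set.uIcc (0 : ℝ) 1, 1 - t * (s * r) ≠ 0 := fun s hs => by
    rw [Set.uIcc_of_le zero_le_one] at hs
    have : s * r ≤ 1 := mul_le_one₀ hs.2 hr.1 hr.2
    have h0 : 0 ≤ s * r := mul_nonneg hs.1 hr.1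
    nlinarith
  -- An explicit antiderivative of `s r / (1 - t s r)^3`.
  have hd : ∀ s ∈ Set.uIcc (0 : ℝ) 1, HasDerivAt
      (fun s : ℝ => r * s ^ 2 / (2 * (1 - t * (s * r)) ^ 2))
      (halfEigen t (s * r) / (1 - t * (s * r))) s := fun s hs => by
    have h := hpos s hs
    have h1 : HasDerivAt (fun s : ℝ => r * s ^ 2) (r * (2 * s)) s := by
      simpa using (hasDerivAt_pow 2 s).const_mul r
    have h2 : HasDerivAt (fun s : ℝ => 1 - t * (s * r)) (-(t * r)) s := by
      simpa using (((hasDerivAt_id s).mul_const r).const_mul t).const_sub 1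
    have h3 : HasDerivAt (fun s : ℝ => 2 * (1 - t * (s * r)) ^ 2)
        (2 * (2 * (1 - t * (s * r)) * -(t * r))) s := by
      simpa using (h2.pow 2).const_mul 2
    refine (h1.div h3 (by positivity)).congr_deriv ?_
    rw [halfEigen]
    field_simp
    ring
  rw [intervalIntegral.integral_eq_sub_of_hasDerivAt hd]
  · simp [halfEigen]
    field_simp
  · refine ContinuousOn.intervalIntegrable ?_
    unfold halfEigen
    exact ContinuousOn.div (ContinuousOn.div (by fun_prop) (by fun_prop)
      fun s hs => pow_ne_zero 2 (hpos s hs)) (by fun_prop) hpos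

/-- Hypothesis and conclusion live on the same closed disc, which contains the segment from `0` to
each of its points, so the estimate can be iterated. -/
theorem norm_cesaro_le_half (ht0 : 0 ≤ t) (ht1 : t < 1) {R K : ℝ} (hR : R < 1)
    (hf : ∀ w, ‖w‖ ≤ R → ‖f w‖ ≤ K * halfEigen t ‖w‖) {z : ℂ} (hz : ‖z‖ ≤ R) :
    ‖cesaro t f z‖ ≤ 1 / 2 * K * halfEigen t ‖z‖ := by
  have hz1 : z ∈ Metric.ball (0 : ℂ) 1 := by simpa using hz.trans_lt hR
  have hz1' : ‖z‖ ≤ 1 := hz.trans hR.le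
  refine (norm_cesaro_le_of_bound ht0 ht1 hz1 (b := fun s => K * halfEigen t (s * ‖z‖)) ?_
    fun s hs => ?_).trans_eq ?_
  · unfold halfEigen
    refine continuousOn_const.mul (ContinuousOn.div (by fun_prop) (by fun_prop) fun s hs => ?_)
    have := one_sub_mul_norm_pos ht0 ht1 (ofReal_mul_mem_ball hz1 hs)
    rw [norm_ofReal_mul hs.1] at this
    positivity
  · have := hf (s * z)
    rw [norm_ofReal_mul hs.1] at this
    exact this ((mul_le_of_le_one_left (norm_nonneg z) hs.2).trans hz)
  · have := integral_halfEigen ht0 ht1 ⟨norm_nonneg z, hz1'⟩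
    simp only [mul_div_assoc, intervalIntegral.integral_const_mul] at this ⊢
    rw [this]
    ring

theorem norm_cesaro_le_of_forall_le (ht0 : 0 ≤ t) (ht1 : t < 1) {z : ℂ}
    (hz : z ∈ Metric.ball (0 : ℂ) 1) {M : ℝ} (hf : ∀ w, ‖w‖ ≤ ‖z‖ → ‖f w‖ ≤ M) :
    ‖cesaro t f z‖ ≤ M / (1 - t) := by
  have hz1 : ‖z‖ < 1 := by simpa using hz
  rw [cesaro_eq_integral]
  have h := intervalIntegral.norm_integral_le_of_norm_le_const (a := (0 : ℝ)) (b := 1)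
    (C := M / (1 - t)) (f := fun s : ℝ => f (s * z) / (1 - t * (s * z))) fun s hs => ?_
  · simpa using h
  · rw [Set.uIoc_of_le zero_le_one] at hs
    have hs' := Set.Ioc_subset_Icc_self hs
    have h1 := one_sub_mul_norm_le ht0 (s * z)
    have h2 : ‖(s * z : ℂ)‖ ≤ ‖z‖ := by
      rw [norm_ofReal_mul hs'.1]
      exact mul_le_of_le_one_left (norm_nonneg z) hs.2
    have h3 := hf _ h2
    rw [norm_div]
    refine div_le_div₀ ((norm_nonneg _).trans h3) h3 (by linarith) (le_trans ?_ h1)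
    nlinarith

/-- The Schwarz lemma gives `‖f w‖ ≤ M / R * ‖w‖`, and `halfEigen t r ≥ r` since its denominator is
at most `1`. -/
theorem norm_le_halfEigen_of_forall_le (ht0 : 0 ≤ t) (ht1 : t < 1)
    (hf : DifferentiableOn ℂ f (Metric.ball 0 1)) (hf0 : f 0 = 0) {R M : ℝ} (hR0 : 0 < R)
    (hR1 : R < 1) (hM : ∀ w, ‖w‖ ≤ R → ‖f w‖ ≤ M) {w : ℂ} (hw : ‖w‖ ≤ R) :
    ‖f w‖ ≤ M / R * halfEigen t ‖w‖ := by
  have hM0 : 0 ≤ M := (norm_nonneg _).trans (hM w hw)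
  have hlin : ‖f w‖ ≤ M / R * ‖w‖ := by
    rcases hw.lt_or_eq with h | h
    · have := Complex.dist_le_div_mul_dist_of_mapsTo_ball (f := f) (c := 0) (R₁ := R) (R₂ := M)
        (hf.mono (Metric.ball_subset_ball hR1.le)) (fun x hx => ?_) (z := w) (by simpa using h)
      · simpa [hf0] using this
      · have hx' : ‖x‖ < R := by simpa using hx
        simpa [hf0] using hM x hx'.le
    -- The Schwarz lemma covers the open disc only; on the circle the claim is the bound `M` itself.
    · rw [h, div_mul_cancel₀ _ hR0.ne']
      exact hM w hw
  refine hlin.trans (mul_le_mul_of_nonneg_left ?_ (by positivity))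
  have h1 : 0 < 1 - t * ‖w‖ := one_sub_mul_norm_pos ht0 ht1 (by simpa using hw.trans_lt hR1)
  rw [halfEigen, le_div_iff₀ (by positivity)]
  refine mul_le_of_le_one_right (norm_nonneg w) (pow_le_one₀ h1.le ?_)
  nlinarith [norm_nonneg w]

theorem cesaro_one_div (ht0 : 0 ≤ t) (ht1 : t < 1) {g : ℂ → ℂ}
    (hg : ∀ z ∈ Metric.ball (0 : ℂ) 1, g z = 1 / (1 - t * z)) {z : ℂ}
    (hz : z ∈ Metric.ball (0 : ℂ) 1) : cesaro t g z = 1 / (1 - t * z) := by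
  have hne : ∀ s ∈ Set.uIcc (0 : ℝ) 1, (1 - t * (s * z) : ℂ) ≠ 0 := fun s hs => by
    rw [Set.uIcc_of_le zero_le_one] at hs
    exact one_sub_mul_ne_zero ht0 ht1 (ofReal_mul_mem_ball hz hs)
  have hd : ∀ s ∈ Set.uIcc (0 : ℝ) 1, HasDerivAt (fun s : ℝ => (s / (1 - t * (s * z)) : ℂ))
      (1 / (1 - t * (s * z)) / (1 - t * (s * z))) s := fun s hs => by
    have h := hne s hs
    have h1 : HasDerivAt (fun s : ℝ => (s : ℂ)) 1 s := Complex.ofRealCLM.hasDerivAt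
    have h2 : HasDerivAt (fun s : ℝ => (1 - t * (s * z) : ℂ)) (-(t * z)) s := by
      simpa using ((h1.mul_const z).const_mul (t : ℂ)).const_sub 1
    refine (h1.div h2 h).congr_deriv ?_
    field_simp
    ring
  rw [cesaro_eq_integral, intervalIntegral.integral_congr
    (g := fun s : ℝ => (1 / (1 - t * (s * z)) / (1 - t * (s * z)) : ℂ)),
    intervalIntegral.integral_eq_sub_of_hasDerivAt hd]
  · simp
  · refine ContinuousOn.intervalIntegrable ?_
    exact (ContinuousOn.div (by fun_prop) (by fun_prop) hne).div (by fun_prop) hne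
  · intro s hs
    have hs' := hs
    rw [Set.uIcc_of_le zero_le_one] at hs'
    simp only [hg _ (ofReal_mul_mem_ball hz hs')]

end Disc

/-! ### The operator on `H_v^∞` -/

namespace HvInf

variable {v : Weight}

/-- The element of `H_v^∞` given by a holomorphic function with a weighted bound. -/
def ofBound (f : ℂ → ℂ) (hf : DifferentiableOn ℂ f (Metric.ball 0 1)) (C : ℝ)
    (hC : ∀ z ∈ Metric.ball (0 : ℂ) 1, wmod v f z ≤ C) : HvInf v :=
  ⟨(Metric.ball (0 : ℂ) 1).indicator f,
    ⟨hf.congr fun _ hz => Set.indicator_of_mem hz f, fun _ hz => Set.indicator_of_notMem hz f⟩, C, by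
      rintro _ ⟨z, rfl⟩
      simpa only [wmod, Set.indicator_of_mem z.2] using hC z z.2⟩

theorem ofBound_apply {f : ℂ → ℂ} (hf : DifferentiableOn ℂ f (Metric.ball 0 1)) {C : ℝ}
    (hC : ∀ z ∈ Metric.ball (0 : ℂ) 1, wmod v f z ≤ C) {z : ℂ} (hz : z ∈ Metric.ball (0 : ℂ) 1) :
    ofBound f hf C hC z = f z :=
  Set.indicator_of_mem hz f

theorem norm_le_of_forall_wmod_le {f : HvInf v} {C : ℝ}
    (hC : ∀ z ∈ Metric.ball (0 : ℂ) 1, wmod v f z ≤ C) : ‖f‖ ≤ C := by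
  have : Nonempty (Metric.ball (0 : ℂ) 1) := ⟨⟨0, by simp⟩⟩
  exact ciSup_le fun z => hC z z.2

theorem differentiableOn (f : HvInf v) : DifferentiableOn ℂ f (Metric.ball 0 1) := f.2.1.1

theorem norm_apply_le (f : HvInf v) {z : ℂ} (hz : z ∈ Metric.ball (0 : ℂ) 1) {w : ℂ}
    (hw : ‖w‖ ≤ ‖z‖) : ‖f w‖ ≤ ‖f‖ / v ‖z‖ := by
  have hz1 : ‖z‖ < 1 := by simpa using hz
  have hw1 : w ∈ Metric.ball (0 : ℂ) 1 := by simpa using hw.trans_lt hz1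
  rw [le_div_iff₀ (v.pos_norm hz)]
  refine le_trans ?_ (wmod_le_norm f w hw1)
  exact mul_le_mul_of_nonneg_left (v.antitoneOn' ⟨norm_nonneg w, hw.trans_lt hz1⟩
    ⟨norm_nonneg z, hz1⟩ hw) (norm_nonneg _)

/-- Evaluation at the origin. -/
def evalZero (v : Weight) : HvInf v →L[ℂ] ℂ :=
  LinearMap.mkContinuous
    { toFun := fun f => f 0
      map_add' := fun _ _ => rfl
      map_smul' := fun _ _ => rfl } (1 / v 0) fun f => by
    have h := norm_apply_le f (z := 0) (by simp) (w := 0) le_rfl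
    rw [norm_zero] at h
    rw [one_div_mul_eq_div]
    exact h

theorem evalZero_apply (f : HvInf v) : evalZero v f = f 0 := rfl

theorem wmod_cesaro_le {t : ℝ} (ht0 : 0 ≤ t) (ht1 : t < 1) (f : HvInf v) {z : ℂ}
    (hz : z ∈ Metric.ball (0 : ℂ) 1) : wmod v (cesaro t f) z ≤ 1 / (1 - t) * ‖f‖ := by
  have h := norm_cesaro_le_of_forall_le ht0 ht1 hz (fun w hw => norm_apply_le f hz hw)
  have hv := v.pos_norm hz
  calc wmod v (cesaro t f) z ≤ ‖f‖ / v ‖z‖ / (1 - t) * v ‖z‖ :=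
        mul_le_mul_of_nonneg_right h hv.le
    _ = _ := by field_simp

/-- The operator `C_t` on `H_v^∞`. -/
def cesaroCLM (v : Weight) {t : ℝ} (ht0 : 0 ≤ t) (ht1 : t < 1) : HvInf v →L[ℂ] HvInf v :=
  LinearMap.mkContinuous
    { toFun := fun f => ofBound (cesaro t f) (differentiableOn_cesaro ht0 ht1 f.differentiableOn) _
        fun _ hz => wmod_cesaro_le ht0 ht1 f hz
      map_add' := fun f g => ext' fun z hz => by
        rw [add_apply, ofBound_apply _ _ hz, ofBound_apply _ _ hz, ofBound_apply _ _ hz,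
          cesaro_eq_integral, cesaro_eq_integral, cesaro_eq_integral,
          ← intervalIntegral.integral_add
            (continuousOn_cesaro_integrand ht0 ht1 f.differentiableOn hz).intervalIntegrable
            (continuousOn_cesaro_integrand ht0 ht1 g.differentiableOn hz).intervalIntegrable]
        simp only [add_apply, add_div]
      map_smul' := fun c f => ext' fun z hz => by
        rw [RingHom.id_apply, smul_apply, ofBound_apply _ _ hz, ofBound_apply _ _ hz,
          cesaro_eq_integral, cesaro_eq_integral, ← intervalIntegral.integral_const_mul]
        simp only [smul_apply, mul_div_assoc] }
    (1 / (1 - t)) fun f => norm_le_of_forall_wmod_le fun z hz => by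
      have h := wmod_cesaro_le ht0 ht1 f hz
      simp only [wmod] at h ⊢
      rwa [← ofBound_apply (v := v) (differentiableOn_cesaro ht0 ht1 f.differentiableOn)
        (fun _ hz => wmod_cesaro_le ht0 ht1 f hz) hz] at h

section Cesaro

variable {t : ℝ} (ht0 : 0 ≤ t) (ht1 : t < 1)

theorem cesaroCLM_apply (f : HvInf v) {z : ℂ} (hz : z ∈ Metric.ball (0 : ℂ) 1) :
    cesaroCLM v ht0 ht1 f z = cesaro t f z :=
  Set.indicator_of_mem hz _

theorem evalZero_cesaroCLM (f : HvInf v) :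
    evalZero v (cesaroCLM v ht0 ht1 f) = evalZero v f := by
  rw [evalZero_apply, cesaroCLM_apply ht0 ht1 f (by simp), cesaro_zero, evalZero_apply]

theorem norm_cesaroCLM_pow_apply_le_halfEigen (f : HvInf v) (hf : f 0 = 0) {R M : ℝ}
    (hR0 : 0 < R) (hR1 : R < 1) (hM : ∀ w, ‖w‖ ≤ R → ‖f w‖ ≤ M) (n : ℕ) {w : ℂ} (hw : ‖w‖ ≤ R) :
    ‖(cesaroCLM v ht0 ht1 ^ n) f w‖ ≤ (1 / 2) ^ n * (M / R) * halfEigen t ‖w‖ := by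
  induction n generalizing w with
  | zero => simpa using norm_le_halfEigen_of_forall_le ht0 ht1 f.differentiableOn hf hR0 hR1 hM hw
  | succ n ih =>
    rw [pow_succ', mul_apply_eq_comp,
      cesaroCLM_apply ht0 ht1 _ (by simpa using hw.trans_lt hR1)]
    refine (norm_cesaro_le_half ht0 ht1 hR1 (fun w hw => ih hw) hw).trans_eq ?_
    ring

/-- At each `z` the majorant is taken with `R = ‖z‖` and `M = ‖f‖ / v ‖z‖`. The weight then cancels,
and so does `1 / R` against the factor `‖z‖` of `halfEigen`, leaving a constant independent of `z`.
-/
theorem norm_cesaroCLM_pow_le (n : ℕ) (f : HvInf v) (hf : evalZero v f = 0) :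
    ‖(cesaroCLM v ht0 ht1 ^ n) f‖ ≤ 1 / (1 - t) ^ 2 * (1 / 2) ^ n * ‖f‖ := by
  have ht : 0 < 1 - t := by linarith
  refine norm_le_of_forall_wmod_le fun z hz => ?_
  have hv := v.pos_norm hz
  have hz1 : ‖z‖ < 1 := by simpa using hz
  rcases eq_or_ne z 0 with rfl | hz0
  · have h : (cesaroCLM v ht0 ht1 ^ n) f 0 = 0 :=
      (pow_apply_invariant (evalZero_cesaroCLM ht0 ht1) n f).trans hf
    rw [wmod, h, norm_zero, zero_mul]
    positivity
  · have hp : 0 < ‖z‖ := norm_pos_iff.2 hz0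
    have h := norm_cesaroCLM_pow_apply_le_halfEigen ht0 ht1 f hf hp hz1
      (fun w hw => norm_apply_le f hz hw) n (le_refl ‖z‖)
    have he : halfEigen t ‖z‖ ≤ ‖z‖ * (1 / (1 - t) ^ 2) := by
      rw [halfEigen, div_eq_mul_one_div]
      have : 1 - t ≤ 1 - t * ‖z‖ := by nlinarith
      gcongr
    calc wmod v ((cesaroCLM v ht0 ht1 ^ n) f) z
        ≤ ((1 / 2) ^ n * (‖f‖ / v ‖z‖ / ‖z‖) * (‖z‖ * (1 / (1 - t) ^ 2))) * v ‖z‖ :=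
          mul_le_mul_of_nonneg_right (h.trans (by gcongr)) hv.le
      _ = _ := by field_simp

end Cesaro

/-! ### Completeness of `H_v^∞` -/

instance : CompleteSpace (HvInf v) := by
  refine Metric.complete_of_cauchySeq_tendsto fun u hu => ?_
  have hcauchy : ∀ ε > 0, ∃ N, ∀ m ≥ N, ∀ n ≥ N, ‖u m - u n‖ < ε := fun ε hε => by
    simpa only [dist_eq_norm] using Metric.cauchySeq_iff.1 hu ε hε
  have hlim : ∀ z ∈ Metric.ball (0 : ℂ) 1, ∃ a, Tendsto (fun n => u n z) atTop (𝓝 a) := by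
    intro z hz
    refine cauchySeq_tendsto_of_complete (Metric.cauchySeq_iff.2 fun ε hε => ?_)
    obtain ⟨N, hN⟩ := hcauchy (ε * v ‖z‖) (mul_pos hε (v.pos_norm hz))
    refine ⟨N, fun m hm n hn => ?_⟩
    rw [dist_eq_norm, ← sub_apply]
    exact (norm_apply_le _ hz le_rfl).trans_lt
      ((div_lt_iff₀ (v.pos_norm hz)).2 (hN m hm n hn))
  choose! F hF using hlim
  have hunif : ∀ ε > 0, ∃ N, ∀ n ≥ N, ∀ z ∈ Metric.ball (0 : ℂ) 1, ‖F z - u n z‖ * v ‖z‖ ≤ ε := by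
    intro ε hε
    obtain ⟨N, hN⟩ := hcauchy ε hε
    refine ⟨N, fun n hn z hz => ?_⟩
    refine le_of_tendsto ((((hF z hz).sub_const (u n z)).norm).mul_const (v ‖z‖)) ?_
    filter_upwards [eventually_ge_atTop N] with m hm
    exact (wmod_le_norm (u m - u n) z hz).trans (hN m hm n hn).le
  -- On a disc of radius `R < 1` the weight is at least `v R > 0`, so weighted uniform convergence
  -- is locally uniform and the limit is holomorphic.
  have hdiff : DifferentiableOn ℂ F (Metric.ball 0 1) := by
    refine TendstoLocallyUniformlyOn.differentiableOn (F := fun n => (u n : ℂ → ℂ)) (φ := atTop) ?_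
      (Eventually.of_forall fun n => (u n).differentiableOn) Metric.isOpen_ball
    rw [Metric.tendstoLocallyUniformlyOn_iff]
    intro ε hε z hz
    have hz1 : ‖z‖ < 1 := by simpa using hz
    obtain ⟨R, hzR, hR1⟩ := exists_between hz1
    have hR0 : 0 ≤ R := (norm_nonneg z).trans hzR.le
    have hvR : 0 < v R := v.pos' R ⟨hR0, hR1⟩
    obtain ⟨N, hN⟩ := hunif (ε / 2 * v R) (by positivity)
    refine ⟨Metric.ball 0 R, mem_nhdsWithin_of_mem_nhds
      (Metric.isOpen_ball.mem_nhds (by simpa using hzR)), ?_⟩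
    filter_upwards [eventually_ge_atTop N] with n hn w hw
    have hwR : ‖w‖ < R := by simpa using hw
    have hw1 : ‖w‖ < 1 := hwR.trans hR1
    have h1 := hN n hn w (by simpa using hw1)
    have h2 : v R ≤ v ‖w‖ := v.antitoneOn' ⟨norm_nonneg w, hw1⟩ ⟨hR0, hR1⟩ hwR.le
    rw [dist_eq_norm]
    have h3 := (mul_le_mul_of_nonneg_left h2 (norm_nonneg (F w - u n w))).trans h1
    have h4 := le_of_mul_le_mul_right h3 hvR
    linarith
  obtain ⟨N, hN⟩ := hunif 1 one_pos
  have hbound : ∀ z ∈ Metric.ball (0 : ℂ) 1, wmod v F z ≤ 1 + ‖u N‖ := by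
    intro z hz
    have h1 := hN N le_rfl z hz
    have h2 := wmod_le_norm (u N) z hz
    have h3 : ‖F z‖ ≤ ‖F z - u N z‖ + ‖u N z‖ := by
      simpa using norm_add_le (F z - u N z) (u N z)
    have h4 := mul_le_mul_of_nonneg_right h3 (v.pos_norm hz).le
    simp only [wmod] at h2 ⊢
    linarith
  refine ⟨ofBound F hdiff _ hbound, Metric.tendsto_atTop.2 fun ε hε => ?_⟩
  obtain ⟨N, hN⟩ := hunif (ε / 2) (by positivity)
  refine ⟨N, fun n hn => ?_⟩
  rw [dist_comm, dist_eq_norm]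
  refine lt_of_le_of_lt (norm_le_of_forall_wmod_le fun z hz => ?_) (half_lt_self hε)
  rw [wmod, sub_apply, ofBound_apply _ _ hz]
  exact hN n hn z hz

end HvInf

/-! ### Boundary decay and the operator on `H_v^0` -/

theorem eventually_mem_ball_comap_norm :
    ∀ᶠ z : ℂ in comap (fun z : ℂ => ‖z‖) (𝓝[<] 1), z ∈ Metric.ball (0 : ℂ) 1 := by
  filter_upwards [tendsto_comap.eventually
    (self_mem_nhdsWithin : Set.Iio (1 : ℝ) ∈ 𝓝[<] (1 : ℝ))] with z hz
  simpa using hz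

theorem vanishesAtBoundary_iff {v : Weight} {f : ℂ → ℂ} :
    VanishesAtBoundary v f ↔ ∀ ε > 0, ∀ᶠ z in comap (fun z : ℂ => ‖z‖) (𝓝[<] 1), wmod v f z ≤ ε := by
  rw [VanishesAtBoundary, Metric.tendsto_nhds]
  constructor
  · intro h ε hε
    filter_upwards [h ε hε] with z hz
    rw [dist_zero_right] at hz
    exact (le_abs_self _).trans hz.le
  · intro h ε hε
    filter_upwards [h (ε / 2) (by positivity), eventually_mem_ball_comap_norm] with z hz hz1
    rw [dist_zero_right, Real.norm_of_nonneg (HvInf.wmod_nonneg f z hz1)]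
    linarith

theorem vanishesAtBoundary_of_bounded {v : Weight} (hv : Tendsto v (𝓝[<] 1) (𝓝 0)) {f : ℂ → ℂ}
    {M : ℝ} (hf : ∀ z ∈ Metric.ball (0 : ℂ) 1, ‖f z‖ ≤ M) : VanishesAtBoundary v f := by
  have h := (hv.comp tendsto_comap : Tendsto (fun z : ℂ => v ‖z‖) _ _).const_mul M
  rw [mul_zero] at h
  refine squeeze_zero' (eventually_mem_ball_comap_norm.mono fun z hz => HvInf.wmod_nonneg f z hz)
    (eventually_mem_ball_comap_norm.mono fun z hz => ?_) h
  exact mul_le_mul_of_nonneg_right (hf z hz) (v.pos_norm hz).le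

/-- For `‖w‖ ≤ ‖z‖` the product `‖f w‖ * v ‖z‖` is small as `‖z‖ → 1`: on a fixed disc `f` is
bounded and `v ‖z‖ → 0`; outside it `v ‖z‖ ≤ v ‖w‖` and `f` itself decays. -/
theorem vanishesAtBoundary_cesaro {v : Weight} (hv : Tendsto v (𝓝[<] 1) (𝓝 0)) {t : ℝ}
    (ht0 : 0 ≤ t) (ht1 : t < 1) {f : ℂ → ℂ} (hf : DifferentiableOn ℂ f (Metric.ball 0 1))
    (hf0 : VanishesAtBoundary v f) : VanishesAtBoundary v (cesaro t f) := by
  have ht : 0 < 1 - t := by linarith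
  rw [vanishesAtBoundary_iff] at hf0 ⊢
  intro ε hε
  -- The factor `1 - t` offsets the loss in `norm_cesaro_le_of_forall_le`.
  have hε' : 0 < ε * (1 - t) := by positivity
  have h1 := hf0 _ hε'
  rw [eventually_comap] at h1
  obtain ⟨r, hr, hrs⟩ := (mem_nhdsLT_iff_exists_Ioo_subset' (show (0 : ℝ) < 1 by norm_num)).1 h1
  obtain ⟨M, hM⟩ := (isCompact_closedBall (0 : ℂ) r).exists_bound_of_continuousOn
    (hf.continuousOn.mono (Metric.closedBall_subset_ball hr))
  have h2 : ∀ᶠ z : ℂ in comap (fun z : ℂ => ‖z‖) (𝓝[<] 1), M * v ‖z‖ < ε * (1 - t) := by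
    have h := (hv.comp tendsto_comap : Tendsto (fun z : ℂ => v ‖z‖) _ _).const_mul M
    rw [mul_zero] at h
    exact h.eventually (gt_mem_nhds hε')
  filter_upwards [h2, eventually_mem_ball_comap_norm] with z hz hzb
  have hvz := v.pos_norm hzb
  have hz1 : ‖z‖ < 1 := by simpa using hzb
  have h := norm_cesaro_le_of_forall_le (f := f) (M := ε * (1 - t) / v ‖z‖) ht0 ht1 hzb fun w hw => ?_
  · calc wmod v (cesaro t f) z ≤ ε * (1 - t) / v ‖z‖ / (1 - t) * v ‖z‖ :=
          mul_le_mul_of_nonneg_right h hvz.le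
      _ = ε := by field_simp
  · rw [le_div_iff₀ hvz]
    rcases le_or_gt ‖w‖ r with hwr | hwr
    · exact (mul_le_mul_of_nonneg_right (hM w (by simpa using hwr)) hvz.le).trans hz.le
    · have hw1 : ‖w‖ < 1 := hw.trans_lt hz1
      exact (mul_le_mul_of_nonneg_left (v.antitoneOn' ⟨norm_nonneg w, hw1⟩ ⟨norm_nonneg z, hz1⟩ hw)
        (norm_nonneg _)).trans (hrs ⟨hwr, hw1⟩ w rfl)

theorem VanishesAtBoundary.congr {v : Weight} {f g : ℂ → ℂ} (hf : VanishesAtBoundary v f)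
    (h : ∀ z ∈ Metric.ball (0 : ℂ) 1, g z = f z) : VanishesAtBoundary v g :=
  Tendsto.congr' (eventually_mem_ball_comap_norm.mono fun z hz => by rw [wmod, wmod, h z hz]) hf

namespace HvZero

variable {v : Weight}

theorem isClosed : IsClosed (HvZero v : Set (HvInf v)) := by
  refine isClosed_of_closure_subset fun f hf => ?_
  refine vanishesAtBoundary_iff.2 fun ε hε => ?_
  obtain ⟨g, hg, hfg⟩ := Metric.mem_closure_iff.1 hf (ε / 2) (by positivity)
  filter_upwards [vanishesAtBoundary_iff.1 hg (ε / 2) (by positivity),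
    eventually_mem_ball_comap_norm] with z hz hzb
  rw [dist_eq_norm] at hfg
  have h1 := HvInf.wmod_le_norm (f - g) z hzb
  have h3 : ‖f z‖ ≤ ‖f z - g z‖ + ‖g z‖ := by simpa using norm_add_le (f z - g z) (g z)
  have h4 := mul_le_mul_of_nonneg_right h3 (v.pos_norm hzb).le
  simp only [wmod, HvInf.sub_apply] at h1 hz ⊢
  linarith

instance : CompleteSpace (HvZero v) := isClosed.completeSpace_coe

theorem cesaroCLM_mem (hv : Tendsto v (𝓝[<] 1) (𝓝 0)) {t : ℝ} (ht0 : 0 ≤ t) (ht1 : t < 1)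
    (f : HvZero v) : HvInf.cesaroCLM v ht0 ht1 f ∈ HvZero v :=
  (vanishesAtBoundary_cesaro hv ht0 ht1 (f : HvInf v).differentiableOn f.2).congr
    fun _ hz => HvInf.cesaroCLM_apply ht0 ht1 _ hz

/-- The operator `C_t` on `H_v^0`. -/
def cesaroCLM (hv : Tendsto v (𝓝[<] 1) (𝓝 0)) {t : ℝ} (ht0 : 0 ≤ t) (ht1 : t < 1) :
    HvZero v →L[ℂ] HvZero v :=
  ((HvInf.cesaroCLM v ht0 ht1).comp (HvZero v).subtypeL).codRestrict (HvZero v)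
    (cesaroCLM_mem hv ht0 ht1)

theorem coe_cesaroCLM_apply (hv : Tendsto v (𝓝[<] 1) (𝓝 0)) {t : ℝ} (ht0 : 0 ≤ t) (ht1 : t < 1)
    (f : HvZero v) : (cesaroCLM hv ht0 ht1 f : HvInf v) = HvInf.cesaroCLM v ht0 ht1 f := rfl

theorem coe_cesaroCLM_pow (hv : Tendsto v (𝓝[<] 1) (𝓝 0)) {t : ℝ} (ht0 : 0 ≤ t) (ht1 : t < 1)
    (n : ℕ) (f : HvZero v) :
    ((cesaroCLM hv ht0 ht1 ^ n) f : HvInf v) = (HvInf.cesaroCLM v ht0 ht1 ^ n) f := by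
  induction n with
  | zero => rfl
  | succ n ih => rw [pow_succ', pow_succ', mul_apply_eq_comp, mul_apply_eq_comp, ← ih,
      coe_cesaroCLM_apply]

/-- Evaluation at the origin on `H_v^0`. -/
def evalZero (v : Weight) : HvZero v →L[ℂ] ℂ := (HvInf.evalZero v).comp (HvZero v).subtypeL

theorem evalZero_apply (f : HvZero v) : evalZero v f = HvInf.evalZero v f := rfl

theorem norm_cesaroCLM_pow_le (hv : Tendsto v (𝓝[<] 1) (𝓝 0)) {t : ℝ} (ht0 : 0 ≤ t) (ht1 : t < 1)
    (n : ℕ) (f : HvZero v) (hf : evalZero v f = 0) :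
    ‖(cesaroCLM hv ht0 ht1 ^ n) f‖ ≤ 1 / (1 - t) ^ 2 * (1 / 2) ^ n * ‖f‖ := by
  rw [evalZero_apply] at hf
  have h := HvInf.norm_cesaroCLM_pow_le ht0 ht1 n (f : HvInf v) hf
  rw [← coe_cesaroCLM_pow hv] at h
  exact h

theorem evalZero_cesaroCLM (hv : Tendsto v (𝓝[<] 1) (𝓝 0)) {t : ℝ} (ht0 : 0 ≤ t) (ht1 : t < 1)
    (f : HvZero v) : evalZero v (cesaroCLM hv ht0 ht1 f) = evalZero v f := by
  rw [evalZero_apply, evalZero_apply, coe_cesaroCLM_apply, HvInf.evalZero_cesaroCLM]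

/-- A bounded holomorphic function as an element of `H_v^0`. -/
def ofBounded (hv : Tendsto v (𝓝[<] 1) (𝓝 0)) (f : ℂ → ℂ)
    (hf : DifferentiableOn ℂ f (Metric.ball 0 1)) (M : ℝ)
    (hM : ∀ z ∈ Metric.ball (0 : ℂ) 1, ‖f z‖ ≤ M) : HvZero v :=
  ⟨HvInf.ofBound f hf (M * v 0) fun z hz =>
      mul_le_mul (hM z hz) (v.antitoneOn' ⟨le_rfl, one_pos⟩ ⟨norm_nonneg z, by simpa using hz⟩
        (norm_nonneg z)) (v.pos_norm hz).le ((norm_nonneg _).trans (hM z hz)),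
    (vanishesAtBoundary_of_bounded hv hM).congr fun _ hz => HvInf.ofBound_apply _ _ hz⟩

theorem ofBounded_apply (hv : Tendsto v (𝓝[<] 1) (𝓝 0)) {f : ℂ → ℂ}
    (hf : DifferentiableOn ℂ f (Metric.ball 0 1)) {M : ℝ}
    (hM : ∀ z ∈ Metric.ball (0 : ℂ) 1, ‖f z‖ ≤ M) {z : ℂ} (hz : z ∈ Metric.ball (0 : ℂ) 1) :
    (ofBounded hv f hf M hM : HvInf v) z = f z :=
  Set.indicator_of_mem hz _

end HvZero

/-! ### Conclusion for both spaces -/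

theorem cesaro_dynamics_of_decay {X : Type*} [NormedAddCommGroup X] [NormedSpace ℂ X]
    [CompleteSpace X] {T : X →L[ℂ] X} {φ : X →L[ℂ] ℂ} {g e : X} {C : ℝ} (hC0 : 0 ≤ C)
    (hg : φ g = 1) (hT : T g = g) (hφ : ∀ x, φ (T x) = φ x)
    (hC : ∀ n x, φ x = 0 → ‖(T ^ n) x‖ ≤ C * (1 / 2) ^ n * ‖x‖) (he : e ≠ 0) (hφe : φ e = 0) :
    PowerBounded T ∧ UniformlyMeanErgodic T ∧ ¬ Supercyclic T ∧
      {f : X | f - T f = 0} = (Submodule.span ℂ {g} : Set X) ∧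
      Set.range (fun f : X => f - T f) = {y : X | φ y = 0} :=
  have h := tendsto_pow_smulRight hC0 hg hT hC
  ⟨.of_tendsto h, .of_tendsto h, not_supercyclic_of_decay hC0 hg hT hφ hC he hφe,
    fixedPoints_eq_span_of_decay hg hT hC, range_id_sub_eq_of_decay hφ hC⟩

theorem mainTheorem3 (v : Weight) (hv : Tendsto v (𝓝[<] 1) (𝓝 0))
    (t : ℝ) (ht0 : 0 ≤ t) (ht1 : t < 1) :
    (∃ T : HvInf v →L[ℂ] HvInf v,
      (∀ f : HvInf v, ∀ z ∈ Metric.ball (0 : ℂ) 1, T f z = cesaro t f z) ∧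
      PowerBounded T ∧ UniformlyMeanErgodic T ∧ ¬ Supercyclic T ∧
      (∃ g₀ : HvInf v, (∀ z ∈ Metric.ball (0 : ℂ) 1, g₀ z = 1 / (1 - t * z)) ∧
        {f : HvInf v | f - T f = 0} = (Submodule.span ℂ {g₀} : Set (HvInf v))) ∧
      Set.range (fun f : HvInf v => f - T f) = {g : HvInf v | g 0 = 0}) ∧
    (∃ T : HvZero v →L[ℂ] HvZero v,
      (∀ f : HvZero v, ∀ z ∈ Metric.ball (0 : ℂ) 1,
        (T f : HvInf v) z = cesaro t (f : HvInf v) z) ∧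
      PowerBounded T ∧ UniformlyMeanErgodic T ∧ ¬ Supercyclic T ∧
      (∃ g₀ : HvZero v, (∀ z ∈ Metric.ball (0 : ℂ) 1, (g₀ : HvInf v) z = 1 / (1 - t * z)) ∧
        {f : HvZero v | f - T f = 0} = (Submodule.span ℂ {g₀} : Set (HvZero v))) ∧
      Set.range (fun f : HvZero v => f - T f) = {g : HvZero v | (g : HvInf v) 0 = 0}) := by
  have ht : 0 < 1 - t := by linarith
  obtain ⟨g, hgz⟩ : ∃ g : HvZero v, ∀ z ∈ Metric.ball (0 : ℂ) 1,
      (g : HvInf v) z = 1 / (1 - t * z) := by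
    refine ⟨HvZero.ofBounded hv (fun z => 1 / (1 - t * z)) (DifferentiableOn.div (by fun_prop)
      (by fun_prop) fun z hz => one_sub_mul_ne_zero ht0 ht1 hz) (1 / (1 - t)) fun z hz => ?_,
      fun z hz => HvZero.ofBounded_apply hv _ _ hz⟩
    have hz1 : ‖z‖ < 1 := by simpa using hz
    rw [norm_div, norm_one]
    refine one_div_le_one_div_of_le ht (le_trans ?_ (one_sub_mul_norm_le ht0 z))
    nlinarith
  -- The identity function is the nonzero vector in the kernel of evaluation that rules out
  -- supercyclicity; like `g`, it is built in `H_v^0` and so serves both spaces.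
  obtain ⟨e, hez⟩ : ∃ e : HvZero v, ∀ z ∈ Metric.ball (0 : ℂ) 1, (e : HvInf v) z = z :=
    ⟨HvZero.ofBounded hv (fun z => z) (by fun_prop) 1 fun z hz => (mem_ball_zero_iff.1 hz).le,
      fun z hz => HvZero.ofBounded_apply hv _ _ hz⟩
  have hg0 : HvInf.evalZero v g = 1 := by
    rw [HvInf.evalZero_apply, hgz 0 (by simp)]
    simp
  have he0 : HvInf.evalZero v e = 0 := hez 0 (by simp)
  have he : (e : HvInf v) ≠ 0 := fun h => by
    have h1 := hez (1 / 2) (by rw [mem_ball_zero_iff]; norm_num)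
    rw [h, HvInf.zero_apply] at h1
    norm_num at h1
  have hTg : HvInf.cesaroCLM v ht0 ht1 g = g := HvInf.ext' fun z hz => by
    rw [HvInf.cesaroCLM_apply ht0 ht1 _ hz, cesaro_one_div ht0 ht1 hgz hz, hgz z hz]
  have hC0 : 0 ≤ 1 / (1 - t) ^ 2 := by positivity
  constructor
  · obtain ⟨h1, h2, h3, h4, h5⟩ := cesaro_dynamics_of_decay hC0 hg0 hTg
      (HvInf.evalZero_cesaroCLM ht0 ht1) (HvInf.norm_cesaroCLM_pow_le ht0 ht1) he he0
    exact ⟨HvInf.cesaroCLM v ht0 ht1, fun f z hz => HvInf.cesaroCLM_apply ht0 ht1 f hz,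
      h1, h2, h3, ⟨g, hgz, h4⟩, h5⟩
  · have hT : HvZero.cesaroCLM hv ht0 ht1 g = g := Subtype.ext hTg
    have hg0' : HvZero.evalZero v g = 1 := hg0
    have he0' : HvZero.evalZero v e = 0 := he0
    have he' : e ≠ 0 := fun h => he (congrArg Subtype.val h)
    have h := cesaro_dynamics_of_decay hC0 hg0' hT
      (HvZero.evalZero_cesaroCLM hv ht0 ht1) (HvZero.norm_cesaroCLM_pow_le hv ht0 ht1) he' he0'
    obtain ⟨h1, h2, h3, h4, h5⟩ := h
    have hap : ∀ f : HvZero v, ∀ z ∈ Metric.ball (0 : ℂ) 1,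
        (HvZero.cesaroCLM hv ht0 ht1 f : HvInf v) z = cesaro t (f : HvInf v) z := fun f z hz => by
      rw [HvZero.coe_cesaroCLM_apply, HvInf.cesaroCLM_apply ht0 ht1 _ hz]
    exact ⟨HvZero.cesaroCLM hv ht0 ht1, hap, h1, h2, h3, ⟨g, hgz, h4⟩, h5⟩

end
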